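/- Let $T$ be a set of opening parentheses, $\overline T=\{\overline a: a\in T\}$ a disjoint copy (the corresponding closing parentheses), $\Sigma=T\cup\overline T$, and $\bar\Sigma=\Sigma\cup\{\varepsilon\}$, where $\varepsilon$ is the empty string. Put $\overline{\overline a}=a$, $\overline\varepsilon=\varepsilon$, and let $\overline{X}=\overline{X[n-1]}\cdots\overline{X[0]}$ be the reverse complement of $X=X[0]\cdots X[n-1]\in\Sigma^*$. Write $X[i..j)=X[i]\cdots X[j-1]$. A *normalized skewmetric* is a function $w:\bar\Sigma\times\bar\Sigma\to[0,\infty]$ with $w(a,a)=0$, $w(a,b)\ge 1$ for $a\ne b$, $w(a,c)\le w(a,b)+w(b,c)$, and $w(a,b)=w(\overline b,\overline a)$ for all $a,b,c\in\bar\Sigma$. For $X,Y\in\Sigma^*$ let $\mathsf{ed}^w(X,Y)$ be the minimum cost of an alignment of $X$ onto $Y$, that is, of a lattice path from $(0,0)$ to $(|X|,|Y|)$ with steps $(x,y)\to(x+1,y)$ of cost $w(X[x],\varepsilon)$, $(x,y)\to(x,y+1)$ of cost $w(\varepsilon,Y[y])$, and $(x,y)\to(x+1,y+1)$ of cost $w(X[x],Y[y])$.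 Let $\mathsf{dyck}^w(X)$ be the minimum (the infimum, if $T$ is infinite) of $\mathsf{ed}^w(X,Y)$ over all $Y$ in the Dyck language, generated by $S\to SS$, $S\to\varepsilon$, $S\to aS\overline a$ $(a\in T)$; let $\mathsf{dyck}^w_{\le k}(X)=\mathsf{dyck}^w(X)$ if $\mathsf{dyck}^w(X)\le k$, and $\mathsf{dyck}^w_{\le k}(X)=\infty$ otherwise. Let $H(i)$ be the number of opening minus the number of closing parentheses in $X[0..i)$. Fragments $X[a..b)\in T^*$ and $X[c..d)\in\overline T^*$ with $b-a=d-c$ and $b\le c$ are *$k$-synchronized* if $H(b)+H(c)-2\min_{b\le m\le c}H(m)\le 2k$. Strings $P,P'\in T^*$ are *$\mathsf{dyck}^w_{\le k}$-equivalent* if $$\mathsf{dyck}^w_{\le k}(X)=\mathsf{dyck}^w_{\le k}\bigl(X[0..a)\cdot P'\cdot X[b..c)\cdot\overline{P'}\cdot X[d..|X|)\bigr)$$ for every string $X\in\Sigma^*$ with $k$-synchronized fragments $X[a..b)=P$ and $X[c..d)=\overline P$. A string in $T^*$ *avoids $k$-periodicity* if it has no substring $Q^{8k+1}$ with $1\le|Q|\le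 4k$. **Theorem.** Let $k\ge 1$ be an integer. 1. For every $Q\in T^*$ and all integers $e,e'\ge 8k$, the strings $Q^e$ and $Q^{e'}$ are $\mathsf{dyck}^w_{\le k}$-equivalent for every normalized skewmetric $w$. 2. Let $P,P'\in T^*$ have lengths at least $156k^3$, with the same prefix of length $78k^3$ and the same suffix of length $78k^3$, and suppose that this prefix and this suffix avoid $k$-periodicity. Then $P$ and $P'$ are $\mathsf{dyck}^w_{\le k}$-equivalent for every normalized skewmetric $w$. 3. For every $P\in T^*$ there is a string $P'\in T^*$ of length at most $156k^3$ that is $\mathsf{dyck}^w_{\le k}$-equivalent to $P$ for every normalized skewmetric $w$. -/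

import Mathlib

open scoped ENNReal NNReal

/-! # Weighted Dyck edit distance -/

namespace DyckEdit

/-- The alphabet `Σ = T ∪ T̄`: `Sum.inl a` is the opening parenthesis `a`, and `Sum.inr a` is the
corresponding closing parenthesis `ā`. -/
abbrev Paren (T : Type*) := T ⊕ T

/-- `Σ̄ = Σ ∪ {ε}`, with `none` in the role of `ε`. -/
abbrev ParenEps (T : Type*) := Option (Paren T)

/-- A string of opening parentheses, seen as a string over `Σ`. -/
def opening {T : Type*} (P : List T) : List (Paren T) := P.map Sum.inl

/-- The involution `p ↦ p̄` on `Σ̄`, with `ε̄ = ε`. -/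
def comp {T : Type*} (p : ParenEps T) : ParenEps T := p.map Sum.swap

/-- The reverse complement of a string. -/
def revComp {T : Type*} (X : List (Paren T)) : List (Paren T) := (X.map Sum.swap).reverse

/-- The Dyck language over `Σ`, by the grammar `S → SS | ∅ | a S ā` for `a ∈ T`. -/
inductive IsDyck {T : Type*} : List (Paren T) → Prop
  | nil : IsDyck []
  | append {X Y : List (Paren T)} : IsDyck X → IsDyck Y → IsDyck (X ++ Y)
  | wrap (a : T) {X : List (Paren T)} : IsDyck X → IsDyck (Sum.inl a :: X ++ [Sum.inr a])

/-- A weight function on `Σ̄` has values in `[0, ∞]` and vanishes on the diagonal. -/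
structure IsWeight {T : Type*} (w : ParenEps T → ParenEps T → ℝ≥0∞) : Prop where
  self : ∀ a, w a a = 0

/-- A weight function is normalized if distinct elements of `Σ̄` have weight at least `1`. -/
def IsNormalized {T : Type*} (w : ParenEps T → ParenEps T → ℝ≥0∞) : Prop :=
  ∀ a b, a ≠ b → 1 ≤ w a b

/-- A skewmetric: a weight function with the triangle inequality and skew-symmetry. -/
structure IsSkewmetric {T : Type*} (w : ParenEps T → ParenEps T → ℝ≥0∞) : Prop
    extends IsWeight w where
  triangle : ∀ a b c, w a c ≤ w a b + w b c
  skew : ∀ a b, w a b = w (comp b) (comp a)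

/-- Alignments of `X` onto `Y`, that is, lattice paths from `(0, 0)` to `(|X|, |Y|)`, listed step by
step from the left: the step `(1, 0)` deletes the next character of `X`, the step `(0, 1)` inserts
the next character of `Y`, and the step `(1, 1)` aligns the next characters of `X` and `Y`. -/
inductive Alignment {A : Type*} : List A → List A → Type _
  | nil : Alignment [] []
  | delete (x : A) {X Y : List A} : Alignment X Y → Alignment (x :: X) Y
  | insert (y : A) {X Y : List A} : Alignment X Y → Alignment X (y :: Y)
  | align (x y : A) {X Y : List A} : Alignment X Y → Alignment (x :: X) (y :: Y)

/-- The cost of an alignment: the sum of the weights of its steps. -/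
noncomputable def Alignment.cost {A : Type*} (w : Option A → Option A → ℝ≥0∞) :
    {X Y : List A} → Alignment X Y → ℝ≥0∞
  | _, _, .nil => 0
  | _, _, .delete x M => w (some x) none + M.cost w
  | _, _, .insert y M => w none (some y) + M.cost w
  | _, _, .align x y M => w (some x) (some y) + M.cost w

/-- The weighted edit distance `ed^w(X, Y)`: the minimum cost of an alignment. -/
noncomputable def ed {A : Type*} (w : Option A → Option A → ℝ≥0∞) (X Y : List A) : ℝ≥0∞ :=
  ⨅ M : Alignment X Y, M.cost w

/-- The weighted Dyck edit distance `dyck^w(X)`: the minimum (for an infinite alphabet, the infimum)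
of `ed^w(X, Y)` over the strings `Y` of the Dyck language. -/
noncomputable def dyck {T : Type*} (w : ParenEps T → ParenEps T → ℝ≥0∞) (X : List (Paren T)) :
    ℝ≥0∞ :=
  ⨅ Y : {Y : List (Paren T) // IsDyck Y}, ed w X Y.1

/-- `dyck^w_{≤ k}(X)`: the weighted Dyck edit distance if it is at most `k`, and `∞` otherwise. -/
noncomputable def dyckLe {T : Type*} (w : ParenEps T → ParenEps T → ℝ≥0∞) (k : ℝ≥0)
    (X : List (Paren T)) : ℝ≥0∞ :=
  if dyck w X ≤ k then dyck w X else ∞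

/-- The fragment `X[i .. j)`. -/
def fragment {A : Type*} (X : List A) (i j : ℕ) : List A := (X.take j).drop i

/-- The height `H(i)`: the number of opening parentheses minus the number of closing parentheses
in `X[0 .. i)`. -/
def height {T : Type*} (X : List (Paren T)) (i : ℕ) : ℤ :=
  ((X.take i).map (Sum.elim (fun _ => 1) (fun _ => -1))).sum

/-- The fragments `X[a .. b)` and `X[c .. d)` are `k`-synchronized. -/
structure Synchronized {T : Type*} (k : ℕ) (X : List (Paren T)) (a b c d : ℕ) : Prop where
  a_le_b : a ≤ b
  b_le_c : b ≤ c
  c_le_d : c ≤ d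
  d_le_length : d ≤ X.length
  left_opening : ∀ p ∈ fragment X a b, p.isLeft
  right_closing : ∀ p ∈ fragment X c d, p.isRight
  same_length : b - a = d - c
  height_le : height X b + height X c
    - 2 * (Finset.Icc b c).inf' (Finset.nonempty_Icc.mpr b_le_c) (height X) ≤ 2 * k

/-- `P, P' ∈ T^*` are `dyck^w_{≤ k}`-equivalent: replacing any `k`-synchronized fragments `P` and
`P̄` of any string by `P'` and `P̄'` preserves `dyck^w_{≤ k}`. -/
def DyckEquiv {T : Type*} (w : ParenEps T → ParenEps T → ℝ≥0∞) (k : ℕ) (P P' : List T) : Prop :=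
  ∀ (X : List (Paren T)) (a b c d : ℕ), Synchronized k X a b c d →
    fragment X a b = opening P → fragment X c d = revComp (opening P) →
    dyckLe w k X = dyckLe w k
      (fragment X 0 a ++ opening P' ++ fragment X b c ++ revComp (opening P')
        ++ fragment X d X.length)

/-- The power `Q^e`: the concatenation of `e` copies of `Q`. -/
def power {A : Type*} (Q : List A) (e : ℕ) : List A := (List.replicate e Q).flatten

/-- `P` avoids `k`-periodicity: it has no substring `Q^{8k+1}` with `1 ≤ |Q| ≤ 4k`. -/
def AvoidsPeriodicity {T : Type*} (k : ℕ) (P : List T) : Prop :=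
  ¬ ∃ Q : List T, 1 ≤ Q.length ∧ Q.length ≤ 4 * k ∧ power Q (8 * k + 1) <:+: P

end DyckEdit

open DyckEdit

namespace DyckEdit

variable {T : Type*} {w : ParenEps T → ParenEps T → ℝ≥0∞}

/-! ## Strings -/

/-! By the triangle inequality and skew-symmetry, insertions are superfluous: inserting the partner
of a parenthesis costs no less than deleting that parenthesis. So `dyck` is the infimum of the costs
of noncrossing partial matchings (`Parse`). Each edit costs at least 1, so a matching of cost below
k + 1 has at most k edits, and each edit shifts heights by at most 2 (`Parse.rise_bounds`).

Take such a matching of U P M P̄ V with M shallow. Height bounds stop a long P from being matched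
mostly elsewhere than to P̄, so peeling the matching from the outside yields layers passing through
P and P̄ together, of which at most k contain edits. If |P| > 6k + (k+1)l, pigeonhole gives l + 1
consecutive exact layers: a fragment F of P matched to the complement of an equal fragment of P,
possibly at another position (`exists_longRun`).

If P = Q^e and |F| = |Q|, then doubling or deleting F at any position of the power gives Q^{e+1} or
Q^{e-1}. The run can therefore be doubled or deleted on both sides at no cost, whatever the two
positions are (`interchangeable_power_succ`).

If P avoids k-periodicity, heights bound the shift between the two occurrences of F by 4k, and a
nonzero shift would make F periodic with too many repetitions. So F is matched to its own
complement, and the matching separates there (`exists_context_of_avoidsPeriodicity`). Separating in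
both the common prefix and the common suffix isolates the middle, which can be exchanged for any
string matched exactly to its complement. For the length bound, powers Q^{8k+1} are shortened to
Q^{8k} until none is left; a string that is still long then loses its middle. -/

/-- The string `P̄` of closing parentheses. -/
abbrev closing (P : List T) : List (Paren T) := revComp (opening P)

/-- The number of opening minus the number of closing parentheses. -/
def rise (X : List (Paren T)) : ℤ := (X.map (Sum.elim (fun _ => 1) (fun _ => -1))).sum

@[simp] lemma rise_nil : rise ([] : List (Paren T)) = 0 := rfl

@[simp] lemma rise_append (X Y : List (Paren T)) : rise (X ++ Y) = rise X + rise Y := by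
  simp [rise]

lemma rise_cons (x : Paren T) (X : List (Paren T)) : rise (x :: X) = rise [x] + rise X := by
  simp [rise]

lemma rise_singleton_bounds (x : Paren T) : -1 ≤ rise [x] ∧ rise [x] ≤ 1 := by
  cases x <;> simp [rise]

@[simp] lemma rise_opening (P : List T) : rise (opening P) = P.length := by
  induction P with
  | nil => rfl
  | cons a P ih => rw [opening, List.map_cons, rise_cons, ← opening, ih]; simp [rise]; ring

@[simp] lemma opening_nil : opening ([] : List T) = [] := rfl

@[simp] lemma closing_nil : closing ([] : List T) = [] := rfl

lemma opening_cons (a : T) (P : List T) : opening (a :: P) = Sum.inl a :: opening P := rfl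

lemma closing_cons (a : T) (P : List T) : closing (a :: P) = closing P ++ [Sum.inr a] := by
  simp [closing, revComp, opening]

@[simp] lemma opening_append (P Q : List T) : opening (P ++ Q) = opening P ++ opening Q := by
  simp [opening]

@[simp] lemma closing_append (P Q : List T) : closing (P ++ Q) = closing Q ++ closing P := by
  simp [closing, revComp, opening]

@[simp] lemma length_opening (P : List T) : (opening P).length = P.length := by simp [opening]

@[simp] lemma length_closing (P : List T) : (closing P).length = P.length := by
  simp [closing, revComp]

@[simp] lemma rise_closing (P : List T) : rise (closing P) = -P.length := by
  induction P with
  | nil => rfl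
  | cons a P ih => rw [closing_cons, rise_append, ih]; simp [rise]; ring

lemma opening_eq_append {P : List T} {X Y : List (Paren T)} (h : opening P = X ++ Y) :
    ∃ A S, P = A ++ S ∧ X = opening A ∧ Y = opening S := by
  obtain ⟨A, S, rfl, rfl, rfl⟩ := List.map_eq_append_iff.mp h
  exact ⟨A, S, rfl, rfl, rfl⟩

lemma revComp_revComp (X : List (Paren T)) : revComp (revComp X) = X := by
  simp [revComp, Function.comp_def]

lemma closing_eq_append {P : List T} {X Y : List (Paren T)} (h : closing P = X ++ Y) :
    ∃ A S, P = A ++ S ∧ X = closing S ∧ Y = closing A := by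
  have h' : opening P = revComp Y ++ revComp X := by
    rw [← revComp_revComp (opening P), show revComp (opening P) = X ++ Y from h]
    simp [revComp]
  obtain ⟨A, S, hP, hY, hX⟩ := opening_eq_append h'
  exact ⟨A, S, hP, by rw [closing, ← hX, revComp_revComp], by rw [closing, ← hY, revComp_revComp]⟩

/-! ## Parses -/

/-- `Parse w X n c`: the string `X` has a noncrossing partial matching with `n` edits and cost `c`,
an edit being an unmatched character, or a matched pair that differs from the pair `a ā` it is
turned into. -/
inductive Parse (w : ParenEps T → ParenEps T → ℝ≥0∞) : List (Paren T) → ℕ → ℝ≥0∞ → Prop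
  | nil : Parse w [] 0 0
  | append {X Y : List (Paren T)} {n m : ℕ} {c d : ℝ≥0∞} :
      Parse w X n c → Parse w Y m d → Parse w (X ++ Y) (n + m) (c + d)
  | single (x : Paren T) : Parse w [x] 1 (w (some x) none)
  | exact (a : T) {X : List (Paren T)} {n : ℕ} {c : ℝ≥0∞} :
      Parse w X n c → Parse w (Sum.inl a :: X ++ [Sum.inr a]) n c
  | pair (p q : Paren T) (a : T) {X : List (Paren T)} {n : ℕ} {c : ℝ≥0∞} :
      p ≠ Sum.inl a ∨ q ≠ Sum.inr a → Parse w X n c →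
      Parse w (p :: X ++ [q]) (n + 1)
        (c + (w (some p) (some (Sum.inl a)) + w (some q) (some (Sum.inr a))))

lemma Parse.congr {X X' : List (Paren T)} {n : ℕ} {c : ℝ≥0∞} (h : Parse w X n c) (hX : X = X') :
    Parse w X' n c := hX ▸ h

lemma Parse.exists_wrap (hw : IsWeight w) (p q : Paren T) (a : T) {X : List (Paren T)} {n : ℕ}
    {c : ℝ≥0∞} (h : Parse w X n c) : ∃ m, Parse w (p :: X ++ [q]) m
      (c + (w (some p) (some (Sum.inl a)) + w (some q) (some (Sum.inr a)))) := by
  by_cases hpq : p = Sum.inl a ∧ q = Sum.inr a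
  · obtain ⟨rfl, rfl⟩ := hpq
    exact ⟨n, by simpa [hw.self] using h.exact a⟩
  · exact ⟨_, h.pair p q a (by tauto)⟩

lemma Parse.edits_le (hw : IsNormalized w) {X : List (Paren T)} {n : ℕ} {c : ℝ≥0∞}
    (h : Parse w X n c) : (n : ℝ≥0∞) ≤ c := by
  induction h with
  | nil => simp
  | append _ _ h₁ h₂ => push_cast; exact add_le_add h₁ h₂
  | single x => simpa using hw (some x) none (by simp)
  | exact a _ h => exact h
  | pair p q a hpq _ h =>
    push_cast
    refine add_le_add h ?_
    rcases hpq with hp | hq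
    · exact (hw _ _ (by simpa using hp)).trans le_self_add
    · exact (hw _ _ (by simpa using hq)).trans le_add_self

/-- With no edits this is the height condition on Dyck strings. A deleted character changes a height
by 1, an edited pair by at most 2. -/
lemma Parse.rise_bounds {X : List (Paren T)} {n : ℕ} {c : ℝ≥0∞} (h : Parse w X n c) :
    ∀ Y Z, X = Y ++ Z → -(2 * n : ℤ) ≤ rise Y ∧ rise Z ≤ 2 * n := by
  induction h with
  | nil =>
    intro Y Z h
    obtain ⟨rfl, rfl⟩ := List.append_eq_nil_iff.mp h.symm
    simp
  | @append X₁ X₂ n m c d _ _ h₁ h₂ =>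
    intro Y Z h
    have b₁ := h₁ X₁ [] (by simp)
    have b₂ := h₂ [] X₂ rfl
    rcases List.append_eq_append_iff.mp h with ⟨A, rfl, rfl⟩ | ⟨A, rfl, rfl⟩
    · have := h₂ A Z rfl
      simp only [rise_append] at *
      push_cast
      constructor <;> linarith
    · have := h₁ Y A rfl
      simp only [rise_append] at *
      push_cast
      constructor <;> linarith
  | single x =>
    intro Y Z h
    have := rise_singleton_bounds x
    rcases List.append_eq_singleton_iff.mp h.symm with ⟨rfl, rfl⟩ | ⟨rfl, rfl⟩ <;> simp <;> omega
  | @exact a X n c _ ih =>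
    intro Y Z h
    have hl : rise [(Sum.inl a : Paren T)] = 1 := by simp [rise]
    have hr : rise [(Sum.inr a : Paren T)] = -1 := by simp [rise]
    have b₁ := (ih X [] (by simp)).1
    have b₂ := (ih [] X rfl).2
    rcases Y with _ | ⟨y, Y⟩
    · obtain rfl : _ = Z := h
      rw [rise_append, rise_cons]
      simp; omega
    · obtain ⟨rfl, h'⟩ := List.cons_eq_cons.mp h
      rcases List.eq_nil_or_concat' Z with rfl | ⟨Z, z, rfl⟩
      · obtain rfl : X ++ [Sum.inr a] = Y := by simpa using h'
        rw [rise_cons, rise_append]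
        simp; omega
      · obtain ⟨rfl, hz⟩ := List.append_inj' (h'.trans (List.append_assoc _ _ _).symm) rfl
        obtain rfl : _ = z := by simpa using hz
        have := ih Y Z rfl
        rw [rise_cons, rise_append]
        omega
  | @pair p q a X n c _ _ ih =>
    intro Y Z h
    have hl := rise_singleton_bounds p
    have hr := rise_singleton_bounds q
    have b₁ := (ih X [] (by simp)).1
    have b₂ := (ih [] X rfl).2
    push_cast
    rcases Y with _ | ⟨y, Y⟩
    · obtain rfl : _ = Z := h
      rw [rise_append, rise_cons]
      simp; omega
    · obtain ⟨rfl, h'⟩ := List.cons_eq_cons.mp h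
      rcases List.eq_nil_or_concat' Z with rfl | ⟨Z, z, rfl⟩
      · obtain rfl : X ++ [q] = Y := by simpa using h'
        rw [rise_cons, rise_append]
        simp; omega
      · obtain ⟨rfl, hz⟩ := List.append_inj' (h'.trans (List.append_assoc _ _ _).symm) rfl
        obtain rfl : _ = z := by simpa using hz
        have := ih Y Z rfl
        rw [rise_cons, rise_append]
        omega

/-! ## Parses and alignments onto Dyck strings -/

lemma exists_alignment_append {X₁ X₂ Y₁ Y₂ : List (Paren T)} (M₁ : Alignment X₁ Y₁)
    (M₂ : Alignment X₂ Y₂) :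
    ∃ M : Alignment (X₁ ++ X₂) (Y₁ ++ Y₂), M.cost w = M₁.cost w + M₂.cost w := by
  induction M₁ with
  | nil => exact ⟨M₂, by simp [Alignment.cost]⟩
  | delete x _ ih =>
    obtain ⟨M, hM⟩ := ih
    exact ⟨.delete x M, by simp [Alignment.cost, hM, add_assoc]⟩
  | insert y _ ih =>
    obtain ⟨M, hM⟩ := ih
    exact ⟨.insert y M, by simp [Alignment.cost, hM, add_assoc]⟩
  | align x y _ ih =>
    obtain ⟨M, hM⟩ := ih
    exact ⟨.align x y M, by simp [Alignment.cost, hM, add_assoc]⟩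

lemma Parse.exists_alignment (hw : IsWeight w) {X : List (Paren T)} {n : ℕ} {c : ℝ≥0∞}
    (h : Parse w X n c) : ∃ Y, IsDyck Y ∧ ∃ M : Alignment X Y, M.cost w = c := by
  induction h with
  | nil => exact ⟨[], .nil, .nil, rfl⟩
  | append _ _ h₁ h₂ =>
    obtain ⟨Y₁, hY₁, M₁, rfl⟩ := h₁
    obtain ⟨Y₂, hY₂, M₂, rfl⟩ := h₂
    exact ⟨_, hY₁.append hY₂, exists_alignment_append M₁ M₂⟩
  | single x => exact ⟨[], .nil, .delete x .nil, by simp [Alignment.cost]⟩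
  | exact a _ h =>
    obtain ⟨Y, hY, M, rfl⟩ := h
    obtain ⟨M', hM'⟩ := exists_alignment_append (w := w) M
      (.align (Sum.inr a) (Sum.inr a) .nil)
    exact ⟨_, hY.wrap a, .align _ _ M', by simp [Alignment.cost, hM', hw.self]⟩
  | pair p q a _ _ h =>
    obtain ⟨Y, hY, M, rfl⟩ := h
    obtain ⟨M', hM'⟩ := exists_alignment_append (w := w) M (.align q (Sum.inr a) .nil)
    exact ⟨_, hY.wrap a, .align _ _ M', by simp [Alignment.cost, hM', add_left_comm]⟩

lemma Parse.dyck_le (hw : IsWeight w) {X : List (Paren T)} {n : ℕ} {c : ℝ≥0∞}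
    (h : Parse w X n c) : dyck w X ≤ c := by
  obtain ⟨Y, hY, M, rfl⟩ := h.exists_alignment hw
  exact iInf_le_of_le ⟨Y, hY⟩ (iInf_le _ M)

lemma Alignment.exists_split {X Y : List (Paren T)} (M : Alignment X Y) :
    ∀ Y₁ Y₂, Y = Y₁ ++ Y₂ → ∃ X₁ X₂, X = X₁ ++ X₂ ∧
      ∃ (M₁ : Alignment X₁ Y₁) (M₂ : Alignment X₂ Y₂), M₁.cost w + M₂.cost w = M.cost w := by
  induction M with
  | nil =>
    intro Y₁ Y₂ h
    obtain ⟨rfl, rfl⟩ := List.append_eq_nil_iff.mp h.symm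
    exact ⟨[], [], rfl, .nil, .nil, by simp [Alignment.cost]⟩
  | delete x M ih =>
    intro Y₁ Y₂ h
    obtain ⟨X₁, X₂, rfl, M₁, M₂, hM⟩ := ih Y₁ Y₂ h
    exact ⟨x :: X₁, X₂, rfl, .delete x M₁, M₂, by simp [Alignment.cost, ← hM, add_assoc]⟩
  | insert y M ih =>
    intro Y₁ Y₂ h
    rcases Y₁ with _ | ⟨z, Y₁⟩
    · obtain rfl : _ = Y₂ := h
      exact ⟨[], _, rfl, .nil, .insert y M, by simp [Alignment.cost]⟩
    · obtain ⟨rfl, h'⟩ := List.cons_eq_cons.mp h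
      obtain ⟨X₁, X₂, rfl, M₁, M₂, hM⟩ := ih Y₁ Y₂ h'
      exact ⟨X₁, X₂, rfl, .insert y M₁, M₂, by simp [Alignment.cost, ← hM, add_assoc]⟩
  | align x y M ih =>
    intro Y₁ Y₂ h
    rcases Y₁ with _ | ⟨z, Y₁⟩
    · obtain rfl : _ = Y₂ := h
      exact ⟨[], _, rfl, .nil, .align x y M, by simp [Alignment.cost]⟩
    · obtain ⟨rfl, h'⟩ := List.cons_eq_cons.mp h
      obtain ⟨X₁, X₂, rfl, M₁, M₂, hM⟩ := ih Y₁ Y₂ h'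
      exact ⟨x :: X₁, X₂, rfl, .align x y M₁, M₂, by simp [Alignment.cost, ← hM, add_assoc]⟩

lemma Alignment.parse_of_nil {X Y : List (Paren T)} (M : Alignment X Y) :
    Y = [] → ∃ n, Parse w X n (M.cost w) := by
  induction M with
  | nil => exact fun _ => ⟨0, .nil⟩
  | delete x M ih =>
    intro h
    obtain ⟨n, hn⟩ := ih h
    exact ⟨_, (Parse.single x).append hn⟩
  | insert y M ih => simp
  | align x y M ih => simp

lemma Alignment.parse_of_singleton {X Y : List (Paren T)} (M : Alignment X Y) (y : Paren T) :
    Y = [y] →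
      (∃ n c, Parse w X n c ∧ M.cost w = c + w none (some y)) ∨
      ∃ X₁ x X₂ n₁ n₂ c₁ c₂, X = X₁ ++ x :: X₂ ∧ Parse w X₁ n₁ c₁ ∧ Parse w X₂ n₂ c₂ ∧
        M.cost w = c₁ + c₂ + w (some x) (some y) := by
  induction M with
  | nil => simp
  | delete x M ih =>
    intro h
    rcases ih h with ⟨n, c, hp, hc⟩ | ⟨X₁, z, X₂, n₁, n₂, c₁, c₂, rfl, h₁, h₂, hc⟩
    · exact .inl ⟨_, _, (Parse.single x).append hp, by simp [Alignment.cost, hc, add_assoc]⟩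
    · exact .inr ⟨x :: X₁, z, X₂, _, _, _, _, rfl, (Parse.single x).append h₁, h₂,
        by simp [Alignment.cost, hc, add_assoc]⟩
  | insert z M ih =>
    intro h
    obtain ⟨rfl, h'⟩ := List.cons_eq_cons.mp h
    obtain ⟨n, hn⟩ := M.parse_of_nil (w := w) h'
    exact .inl ⟨n, _, hn, by simp [Alignment.cost, add_comm]⟩
  | align x z M ih =>
    intro h
    obtain ⟨rfl, h'⟩ := List.cons_eq_cons.mp h
    obtain ⟨n, hn⟩ := M.parse_of_nil (w := w) h'
    exact .inr ⟨[], x, _, _, _, _, _, rfl, .nil, hn, by simp [Alignment.cost, add_comm]⟩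

/-- For each pair `a ā` of the Dyck string: if both ends are inserted, drop the pair; if one is,
delete the character aligned to the other; if neither is, match the two aligned characters. -/
lemma IsDyck.exists_parse (hw : IsSkewmetric w) {Y : List (Paren T)} (hY : IsDyck Y) :
    ∀ {X : List (Paren T)} (M : Alignment X Y), ∃ n c, Parse w X n c ∧ c ≤ M.cost w := by
  induction hY with
  | nil =>
    intro X M
    obtain ⟨n, hn⟩ := M.parse_of_nil (w := w) rfl
    exact ⟨n, _, hn, le_rfl⟩
  | append _ _ h₁ h₂ =>
    intro X M
    obtain ⟨X₁, X₂, rfl, M₁, M₂, hM⟩ := M.exists_split (w := w) _ _ rfl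
    obtain ⟨n₁, c₁, p₁, l₁⟩ := h₁ M₁
    obtain ⟨n₂, c₂, p₂, l₂⟩ := h₂ M₂
    exact ⟨_, _, p₁.append p₂, hM ▸ add_le_add l₁ l₂⟩
  | @wrap a Y _ ih =>
    intro X M
    obtain ⟨X', X₃, rfl, M', M₃, hM⟩ := M.exists_split (w := w) _ _ rfl
    obtain ⟨X₁, X₂, rfl, M₁, M₂, hM'⟩ := M'.exists_split (w := w) [Sum.inl a] Y rfl
    obtain ⟨n, c, hp, hc⟩ := ih M₂
    -- Inserting one end costs as much as deleting the other, so the triangle inequality pays for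
    -- deleting the character aligned to that other end.
    have hl : w none (some (Sum.inl a)) = w (some (Sum.inr a)) none := hw.skew _ _
    have hr : w none (some (Sum.inr a)) = w (some (Sum.inl a)) none := hw.skew _ _
    rcases M₁.parse_of_singleton (w := w) _ rfl with
      ⟨n₁, c₁, p₁, e₁⟩ | ⟨A₁, x, B₁, n₁, m₁, c₁, d₁, rfl, p₁, q₁, e₁⟩ <;>
    rcases M₃.parse_of_singleton (w := w) _ rfl with
      ⟨n₃, c₃, p₃, e₃⟩ | ⟨A₃, y, B₃, n₃, m₃, c₃, d₃, rfl, p₃, q₃, e₃⟩ <;>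
    rw [← hM, ← hM', e₁, e₃]
    · refine ⟨_, _, (p₁.append hp).append p₃, ?_⟩
      gcongr <;> exact le_self_add
    · refine ⟨_, _, (((p₁.append hp).append p₃).append ((Parse.single y).append q₃)).congr
        (by simp), ?_⟩
      have := hw.triangle (some y) (some (Sum.inr a)) none
      calc c₁ + c + c₃ + (w (some y) none + d₃)
          ≤ c₁ + M₂.cost w + c₃ +
            (w (some y) (some (Sum.inr a)) + w (some (Sum.inr a)) none + d₃) := by gcongr
        _ = _ := by rw [hl]; ring
    · refine ⟨_, _, ((((p₁.append (.single x)).append q₁).append hp).append p₃).congr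
        (by simp), ?_⟩
      have := hw.triangle (some x) (some (Sum.inl a)) none
      calc c₁ + w (some x) none + d₁ + c + c₃
          ≤ c₁ + (w (some x) (some (Sum.inl a)) + w (some (Sum.inl a)) none) + d₁ +
            M₂.cost w + c₃ := by gcongr
        _ = _ := by rw [hr]; ring
    · obtain ⟨m, hm⟩ := ((q₁.append hp).append p₃).exists_wrap hw.toIsWeight x y a
      refine ⟨_, _, ((p₁.append hm).append q₃).congr (by simp), ?_⟩
      calc _ ≤ c₁ + (d₁ + M₂.cost w + c₃ +
            (w (some x) (some (Sum.inl a)) + w (some y) (some (Sum.inr a)))) + d₃ := by gcongr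
        _ = _ := by ring

lemma exists_parse_of_dyck_lt (hw : IsSkewmetric w) {X : List (Paren T)} {b : ℝ≥0∞}
    (h : dyck w X < b) : ∃ n c, Parse w X n c ∧ c < b := by
  obtain ⟨⟨Y, hY⟩, h⟩ := iInf_lt_iff.mp h
  obtain ⟨M, h⟩ := iInf_lt_iff.mp h
  obtain ⟨n, c, hp, hc⟩ := hY.exists_parse hw M
  exact ⟨n, c, hp, hc.trans_lt h⟩

/-! ## Contexts -/

/-- `Context w A C c`: surrounding a string by `A` and `C` increases its parsing cost by at most
`c`. -/
def Context (w : ParenEps T → ParenEps T → ℝ≥0∞) (A C : List (Paren T)) (c : ℝ≥0∞) : Prop :=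
  ∀ B n b, Parse w B n b → ∃ m, Parse w (A ++ B ++ C) m (b + c)

lemma Context.nil : Context w [] [] 0 := fun B n b h => ⟨n, by simpa using h⟩

lemma Context.comp {A A' C C' : List (Paren T)} {c c' : ℝ≥0∞} (h : Context w A C c)
    (h' : Context w A' C' c') : Context w (A ++ A') (C' ++ C) (c + c') := by
  intro B n b hB
  obtain ⟨m, hm⟩ := h' B n b hB
  obtain ⟨l, hl⟩ := h _ m _ hm
  exact ⟨l, by simpa [add_assoc, add_comm c] using hl⟩

lemma Parse.surround {X : List (Paren T)} {n : ℕ} {c : ℝ≥0∞} (h : Parse w X n c) (P : List T) :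
    Parse w (opening P ++ X ++ closing P) n c := by
  induction P with
  | nil => simpa using h
  | cons a P ih => exact (ih.exact a).congr (by simp [opening_cons, closing_cons])

lemma Context.exact (P : List T) : Context w (opening P) (closing P) 0 :=
  fun _ n _ h => ⟨n, by simpa using h.surround P⟩

/-! ### Peeling a parse from the outside -/

/-- One step from a parse towards the inside: a matched pair of outermost characters, or a parsed
prefix or suffix. -/
inductive Layer (w : ParenEps T → ParenEps T → ℝ≥0∞) :
    List (Paren T) → List (Paren T) → ℕ → ℝ≥0∞ → Prop
  | exact (a : T) : Layer w [Sum.inl a] [Sum.inr a] 0 0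
  | pair (p q : Paren T) (a : T) : p ≠ Sum.inl a ∨ q ≠ Sum.inr a →
      Layer w [p] [q] 1 (w (some p) (some (Sum.inl a)) + w (some q) (some (Sum.inr a)))
  | left {Y : List (Paren T)} {n : ℕ} {c : ℝ≥0∞} : Y ≠ [] → Parse w Y n c → Layer w Y [] n c
  | right {Y : List (Paren T)} {n : ℕ} {c : ℝ≥0∞} : Y ≠ [] → Parse w Y n c → Layer w [] Y n c

lemma Layer.context {A C : List (Paren T)} {n : ℕ} {c : ℝ≥0∞} (h : Layer w A C n c) :
    Context w A C c := by
  intro B m b hB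
  cases h with
  | exact a => exact ⟨m, by simpa using hB.exact a⟩
  | pair p q a hpq => exact ⟨_, hB.pair p q a hpq⟩
  | left _ hY => exact ⟨_, by simpa [add_comm] using hY.append hB⟩
  | right _ hY => exact ⟨_, by simpa using hB.append hY⟩

lemma Layer.length_pos {A C : List (Paren T)} {n : ℕ} {c : ℝ≥0∞} (h : Layer w A C n c) :
    0 < A.length + C.length := by
  cases h with
  | exact | pair => simp
  | left hY | right hY => have := List.length_pos_iff.mpr hY; simp; omega

/-- The layer that first enters `P` consumes at most `2 * n` of it: a parsed string that ends in
opening parentheses has at most `2 * n` of them there, and a pair has only one character on the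
left. -/
lemma Layer.left_le {A C : List (Paren T)} {n : ℕ} {c : ℝ≥0∞} (h : Layer w A C n c)
    {B : List (Paren T)} {P : List T} (hP : opening P <:+ A ++ B) (hB : B.length ≤ P.length)
    (hA : P.length < A.length + B.length) : P.length ≤ B.length + 2 * n := by
  cases h with
  | exact | pair => simp at hA; omega
  | right => simp at hA; omega
  | left _ hY =>
    obtain ⟨D, hD⟩ := hP
    rcases List.append_eq_append_iff.mp hD with ⟨E, rfl, hE⟩ | ⟨E, rfl, hE⟩
    · obtain ⟨P₁, P₂, rfl, rfl, -⟩ := opening_eq_append hE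
      have h₁ := (hY.rise_bounds _ _ rfl).2
      have h₂ := congrArg List.length hE
      rw [rise_opening] at h₁
      simp at h₂ ⊢
      omega
    · have := congrArg List.length hE
      simp at this hA
      omega

lemma Layer.right_le {A C : List (Paren T)} {n : ℕ} {c : ℝ≥0∞} (h : Layer w A C n c)
    {B : List (Paren T)} {P : List T} (hP : closing P <+: B ++ C) (hB : B.length ≤ P.length)
    (hC : P.length < B.length + C.length) : P.length ≤ B.length + 2 * n := by
  cases h with
  | exact | pair => simp at hC; omega
  | left => simp at hC; omega
  | right _ hY =>
    obtain ⟨D, hD⟩ := hP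
    rcases List.append_eq_append_iff.mp hD with ⟨E, hE, rfl⟩ | ⟨E, hE, rfl⟩
    · have := congrArg List.length hE
      simp at this hC
      omega
    · have h₁ := (hY.rise_bounds _ _ rfl).1
      have h₂ := congrArg List.length hE
      obtain ⟨P₁, P₂, rfl, -, rfl⟩ := closing_eq_append hE
      rw [rise_closing] at h₁
      simp at h₂ ⊢
      omega

/-- A parse of `L ++ M ++ R` has an outermost layer within `L` and `R`, or splits within `M`. -/
lemma Parse.peel {Z : List (Paren T)} {n : ℕ} {c : ℝ≥0∞} (h : Parse w Z n c) :
    ∀ L M R, Z = L ++ M ++ R →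
      (∃ A L' C R' n₁ n₂ c₁ c₂, L = A ++ L' ∧ R = R' ++ C ∧ Layer w A C n₁ c₁ ∧
        Parse w (L' ++ M ++ R') n₂ c₂ ∧ n₁ + n₂ ≤ n ∧ c₁ + c₂ ≤ c) ∨
      ∃ M₁ M₂ n₁ n₂ c₁ c₂, M = M₁ ++ M₂ ∧ Parse w (L ++ M₁) n₁ c₁ ∧ Parse w (M₂ ++ R) n₂ c₂ ∧
        n₁ + n₂ ≤ n := by
  induction h with
  | nil =>
    intro L M R hZ
    obtain ⟨h, rfl⟩ := List.append_eq_nil_iff.mp hZ.symm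
    obtain ⟨rfl, rfl⟩ := List.append_eq_nil_iff.mp h
    exact .inr ⟨[], [], 0, 0, 0, 0, rfl, .nil, .nil, le_rfl⟩
  | @append X Y n m c d hX hY ihX ihY =>
    intro L M R hZ
    rw [List.append_assoc] at hZ
    rcases List.append_eq_append_iff.mp hZ with ⟨D, rfl, rfl⟩ | ⟨D, rfl, hD⟩
    rotate_left
    · rcases List.append_eq_append_iff.mp hD with ⟨E, rfl, rfl⟩ | ⟨E, rfl, rfl⟩
      -- Layers must be nonempty so that peeling terminates; an empty piece is skipped by recursing
      -- into the other one.
      · by_cases hE : Y = []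
        · subst hE
          rcases ihX L M E (by simp) with
            ⟨A, L', C, R', n₁, n₂, c₁, c₂, h₁, h₂, h₃, h₄, h₅, h₆⟩ |
            ⟨M₁, M₂, n₁, n₂, c₁, c₂, h₁, h₂, h₃, h₄⟩
          · exact .inl ⟨A, L', C, R', n₁, n₂, c₁, c₂, h₁, by simpa using h₂, h₃, h₄,
              h₅.trans (by omega), h₆.trans le_self_add⟩
          · exact .inr ⟨M₁, M₂, n₁, n₂, c₁, c₂, h₁, h₂, by simpa using h₃, by omega⟩
        · exact .inl ⟨[], L, Y, E, m, n, d, c, rfl, rfl, .right hE hY, by simpa using hX,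
            by omega, (add_comm _ _).le⟩
      · exact .inr ⟨D, E, n, m, c, d, rfl, hX, hY, le_rfl⟩
    · by_cases hX' : X = []
      · subst hX'
        rcases ihY D M R (by simp) with
          ⟨A, L', C, R', n₁, n₂, c₁, c₂, h₁, h₂, h₃, h₄, h₅, h₆⟩ |
          ⟨M₁, M₂, n₁, n₂, c₁, c₂, h₁, h₂, h₃, h₄⟩
        · exact .inl ⟨A, L', C, R', n₁, n₂, c₁, c₂, by simpa using h₁, h₂, h₃, h₄,
            h₅.trans (by omega), h₆.trans le_add_self⟩
        · exact .inr ⟨M₁, M₂, n₁, n₂, c₁, c₂, h₁, by simpa using h₂, h₃, by omega⟩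
      · exact .inl ⟨X, D, [], R, n, m, c, d, rfl, by simp, .left hX' hX, by simpa using hY,
          le_rfl, le_rfl⟩
  | single x =>
    intro L M R hZ
    have hp := Parse.single (w := w) x
    rw [List.append_assoc] at hZ
    rcases List.append_eq_singleton_iff.mp hZ.symm with ⟨rfl, h⟩ | ⟨rfl, h⟩
    · exact .inr ⟨[], M, 0, 1, 0, _, rfl, .nil, h ▸ hp, by simp⟩
    · obtain ⟨rfl, rfl⟩ := List.append_eq_nil_iff.mp h
      exact .inr ⟨[], [], 1, 0, _, 0, rfl, hp, .nil, by simp⟩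
  | @exact a X n c hX _ =>
    intro L M R hZ
    have hp := hX.exact a
    rcases L with _ | ⟨p, L⟩
    -- With one side exhausted there is no pair to peel, and the split at that end of `M` is
    -- trivial.
    · exact .inr ⟨[], M, 0, n, 0, c, rfl, .nil, hp.congr (by simpa using hZ), by simp⟩
    rcases List.eq_nil_or_concat' R with rfl | ⟨R, q, rfl⟩
    · exact .inr ⟨M, [], n, 0, c, 0, by simp, hp.congr (by simpa using hZ), .nil, by simp⟩
    obtain ⟨rfl, hZ'⟩ := List.cons_eq_cons.mp hZ
    obtain ⟨rfl, hq⟩ := List.append_inj' (hZ'.trans (List.append_assoc _ _ _).symm) rfl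
    obtain rfl : _ = q := by simpa using hq
    exact .inl ⟨_, L, _, R, 0, n, 0, c, rfl, rfl, .exact a, hX, by simp, by simp⟩
  | @pair p' q' a X n c hpq hX _ =>
    intro L M R hZ
    have hp := hX.pair p' q' a hpq
    rcases L with _ | ⟨p, L⟩
    · exact .inr ⟨[], M, 0, _, 0, _, rfl, .nil, hp.congr (by simpa using hZ), by simp⟩
    rcases List.eq_nil_or_concat' R with rfl | ⟨R, q, rfl⟩
    · exact .inr ⟨M, [], _, 0, _, 0, by simp, hp.congr (by simpa using hZ), .nil, by simp⟩
    obtain ⟨rfl, hZ'⟩ := List.cons_eq_cons.mp hZ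
    obtain ⟨rfl, hq⟩ := List.append_inj' (hZ'.trans (List.append_assoc _ _ _).symm) rfl
    obtain rfl : _ = q := by simpa using hq
    exact .inl ⟨_, L, _, R, 1, n, _, c, rfl, rfl, .pair _ _ a hpq, hX, by omega,
      (add_comm _ _).le⟩

/-- The prefixes of `M` have height at least `μ`. -/
def HeightGE (μ : ℤ) (M : List (Paren T)) : Prop := ∀ M₁ M₂, M = M₁ ++ M₂ → μ ≤ rise M₁

/-- Inside any parse of `U P M P̄ V`, the layers lead to an alignment of suffixes of `P` and `P̄`,
unless `P` is short. -/
lemma exists_context_enter {U V M : List (Paren T)} {P : List T} {μ : ℤ} (hμ : HeightGE μ M) :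
    ∀ (N : ℕ) (L R : List (Paren T)) (n : ℕ) (c : ℝ≥0∞), L.length + R.length ≤ N →
    Parse w (L ++ M ++ R) n c → L <:+ U ++ opening P → R <+: closing P ++ V →
    P.length < L.length ∨ P.length < R.length →
    2 * n - μ < P.length → 2 * n + rise M - μ < P.length →
    ∃ A L' C R' n₁ n₂ c₁ c₂, L = A ++ L' ∧ R = R' ++ C ∧ Context w A C c₁ ∧
      Parse w (L' ++ M ++ R') n₂ c₂ ∧ n₁ + n₂ ≤ n ∧ c₁ + c₂ ≤ c ∧
      L'.length ≤ P.length ∧ R'.length ≤ P.length ∧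
      (P.length ≤ L'.length + 2 * n₁ ∨ P.length ≤ R'.length + 2 * n₁) := by
  intro N
  induction N with
  | zero => intros; omega
  | succ N ih =>
    intro L R n c hN hZ hL hR hout hn hn'
    have hPL (h : P.length < L.length) : opening P <:+ L :=
      List.suffix_of_suffix_length_le (List.suffix_append _ _) hL (by simpa using h.le)
    have hPR (h : P.length < R.length) : closing P <+: R :=
      List.prefix_of_prefix_length_le (List.prefix_append _ _) hR (by simpa using h.le)
    rcases hZ.peel L M R rfl with
      ⟨A, L', C, R', n₁, n₂, c₁, c₂, rfl, rfl, hlay, hZ', hnn, hcc⟩ |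
      ⟨M₁, M₂, n₁, n₂, c₁, c₂, rfl, h₁, h₂, hnn⟩
    · have hpos := hlay.length_pos
      simp only [List.length_append] at hN hout
      by_cases hout' : P.length < L'.length ∨ P.length < R'.length
      · obtain ⟨A', L'', C', R'', m₁, m₂, d₁, d₂, rfl, rfl, hctx, hZ'', hm, hd, hr⟩ :=
          ih L' R' n₂ c₂ (by omega) hZ' ((List.suffix_append _ _).trans hL)
            ((List.prefix_append _ _).trans hR) hout' (by omega) (by omega)
        refine ⟨A ++ A', L'', C' ++ C, R'', m₁, m₂, c₁ + d₁, d₂, by simp, by simp,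
          hlay.context.comp hctx, hZ'', by omega, ?_, hr⟩
        rw [add_assoc]
        exact (add_le_add_right hd _).trans hcc
      · push Not at hout'
        refine ⟨A, L', C, R', n₁, n₂, c₁, c₂, rfl, rfl, hlay.context, hZ', hnn, hcc, hout'.1,
          hout'.2, ?_⟩
        rcases hout with h | h
        · exact .inl (hlay.left_le (hPL (by simpa using h)) hout'.1 h)
        · exact .inr (hlay.right_le (hPR (by simpa using h)) hout'.2 h)
    -- After a split within `M`, all of `P` (or `P̄`) and a part of `M` would form a suffix (or
    -- prefix) of a parsed string, with height beyond what `n` edits allow.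
    · exfalso
      have := hμ M₁ M₂ rfl
      rw [rise_append] at hn'
      rcases hout with h | h
      · obtain ⟨D, rfl⟩ := hPL h
        have := (h₁.rise_bounds D (opening P ++ M₁) (by simp)).2
        simp only [rise_append, rise_opening] at this
        omega
      · obtain ⟨D, rfl⟩ := hPR h
        have := (h₂.rise_bounds (M₂ ++ closing P) D (by simp)).1
        simp only [rise_append, rise_closing] at this
        omega

lemma Layer.exact_or_edit {B B' : List T} {n : ℕ} {c : ℝ≥0∞}
    (h : Layer w (opening B) (closing B') n c) :
    (∃ a, B = [a] ∧ B' = [a]) ∨ 1 ≤ n ∧ B.length ≤ 2 * n := by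
  generalize hX : opening B = X at h
  generalize hY : closing B' = Y at h
  have hX' := congrArg List.length hX
  have hY' := congrArg List.length hY
  cases h with
  | exact a =>
    left
    simp only [length_opening, length_closing, List.length_singleton] at hX' hY'
    obtain ⟨b, rfl⟩ := List.length_eq_one_iff.mp hX'
    obtain ⟨b', rfl⟩ := List.length_eq_one_iff.mp hY'
    simp_all [opening, closing, revComp]
  | pair => right; simp at hX'; omega
  | left hne hp =>
    right
    subst hX
    have := (hp.rise_bounds [] _ (List.nil_append _).symm).2
    rw [rise_opening] at this
    have := List.length_pos_iff.mpr hne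
    rw [length_opening] at this
    omega
  | right hne hp =>
    right
    subst hY
    have := (hp.rise_bounds _ [] (List.append_nil _).symm).1
    rw [rise_closing] at this
    have := List.length_pos_iff.mpr hne
    rw [length_closing] at this
    simp only [length_opening, List.length_nil] at hX'
    omega

/-! ### Long runs of exact pairs -/

/-- `LongRun w M P P' l n c`: a parse of `P M P̄'` matches a fragment of length `l` of `P` and the
complement of an equal fragment of `P'` to each other, with at most `n` edits between them, and
total cost at most `c`. -/
def LongRun (w : ParenEps T → ParenEps T → ℝ≥0∞) (M : List (Paren T)) (P P' : List T)
    (l n : ℕ) (c : ℝ≥0∞) : Prop :=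
  ∃ A F S A' S' c₁ n₂ c₂, P = A ++ F ++ S ∧ P' = A' ++ F ++ S' ∧ F.length = l ∧
    Context w (opening A) (closing A') c₁ ∧
    Parse w (opening S ++ M ++ closing S') n₂ c₂ ∧ n₂ ≤ n ∧ c₁ + c₂ ≤ c

lemma LongRun.extend {M : List (Paren T)} {B B' P P' : List T} {l n m : ℕ} {b c d : ℝ≥0∞}
    (h : LongRun w M P P' l n c) (hc : Context w (opening B) (closing B') b)
    (hn : n ≤ m) (hd : b + c ≤ d) : LongRun w M (B ++ P) (B' ++ P') l m d := by
  obtain ⟨A, F, S, A', S', c₁, n₂, c₂, rfl, rfl, hF, hctx, hp, hn', hc'⟩ := h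
  refine ⟨B ++ A, F, S, B' ++ A', S', b + c₁, n₂, c₂, by simp, by simp, hF,
    by simpa using hc.comp hctx, hp, hn'.trans hn, ?_⟩
  rw [add_assoc]
  exact (add_le_add_right hc' _).trans hd

/-- A parse of `P M P̄'` has a long run, unless `P` is short. Here `P = E S` and `P' = E S'`, and `E`
is matched to its complement. -/
lemma longRun_or_length_le {M : List (Paren T)} {μ : ℤ} (hμ : HeightGE μ M) (l : ℕ) :
    ∀ (N : ℕ) (E S S' : List T) (n : ℕ) (c : ℝ≥0∞), S.length + S'.length ≤ N → E.length ≤ l →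
    Parse w (opening S ++ M ++ closing S') n c →
    LongRun w M (E ++ S) (E ++ S') (l + 1) n c ∨
      (S.length + E.length : ℤ) ≤ 2 * n - μ + (n + 1) * l := by
  intro N
  induction N with
  | zero =>
    intro E S S' n c hN hE hp
    right
    have := hμ [] M rfl
    rw [rise_nil] at this
    have : (0 : ℤ) ≤ n * l := by positivity
    have : S.length = 0 := by omega
    rw [this, add_mul]
    push_cast
    omega
  | succ N ih =>
    intro E S S' n c hN hE hp
    rcases hp.peel _ _ _ rfl with
      ⟨A, L, C, R, n₁, n₂, c₁, c₂, hS, hS', hlay, hp', hnn, hcc⟩ |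
      ⟨M₁, M₂, n₁, n₂, c₁, c₂, rfl, h₁, h₂, hnn⟩
    · obtain ⟨B, S, rfl, rfl, rfl⟩ := opening_eq_append hS
      obtain ⟨B', S', rfl, rfl, rfl⟩ := closing_eq_append hS'
      have hpos := hlay.length_pos
      simp only [List.length_append, length_opening, length_closing] at hN hpos
      rcases hlay.exact_or_edit with ⟨a, rfl, rfl⟩ | ⟨hn₁, hB⟩
      · by_cases hE' : E.length = l
        · exact .inl ⟨[], E ++ [a], S, [], S', 0, n₂, c₂, by simp, by simp, by simp [hE'],
            .nil, hp', by omega, by simpa using le_add_self.trans hcc⟩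
        -- `E` is the current run, of length at most `l`; an exact pair lengthens it.
        · rcases ih (E ++ [a]) S S' n₂ c₂ (by omega) (by simp; omega) hp' with h | h
          · left
            simpa using h.extend (m := n) (d := c) (b := 0) (B := []) (B' := [])
              Context.nil (by omega)
              (by simpa using le_add_self.trans hcc)
          · right
            have : ((n₂ : ℤ) + 1) * l ≤ (n + 1) * l := by gcongr; omega
            simp at h ⊢
            omega
      -- An edited layer starts a new run. It uses up at least one edit, which pays for the `l`
      -- characters of the old run, and at most `2 * n₁` characters of its own.
      · rcases ih [] S S' n₂ c₂ (by omega) (by simp) hp' with h | h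
        · left
          have := h.extend (m := n) (d := c) (B := E ++ B) (B' := E ++ B')
            (by simpa using (Context.exact E).comp hlay.context) (by omega) (by simpa using hcc)
          simpa using this
        · right
          have : ((n₂ : ℤ) + 1 + 1) * l ≤ (n + 1) * l := by gcongr; omega
          rw [add_mul _ 1] at this
          simp at h ⊢
          omega
    · right
      have h := (h₁.rise_bounds [] _ (List.nil_append _).symm).2
      have := hμ M₁ M₂ rfl
      rw [rise_append, rise_opening] at h
      have : (0 : ℤ) ≤ n * l := by positivity
      rw [add_mul]
      omega

/-- `M` climbs down and up by at most `2k` in total, relative to its ends. -/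
def Shallow (k : ℕ) (M : List (Paren T)) : Prop := ∃ μ, HeightGE μ M ∧ rise M - 2 * μ ≤ 2 * k

/-- The total rise is unchanged, and the minimum height does not drop. This lets characters of `P`
next to `M` be absorbed into `M`. -/
lemma Shallow.surround {k : ℕ} {M : List (Paren T)} (h : Shallow k M) (P : List T) :
    Shallow k (opening P ++ M ++ closing P) := by
  obtain ⟨μ, hμ, hk⟩ := h
  have h₀ := hμ [] M rfl
  have h₁ := hμ M [] (by simp)
  rw [rise_nil] at h₀
  refine ⟨min (min 0 (rise M)) (P.length + μ), ?_, ?_⟩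
  · intro Y Z hYZ
    rw [List.append_assoc] at hYZ
    rcases List.append_eq_append_iff.mp hYZ with ⟨D, rfl, hD⟩ | ⟨D, hD, rfl⟩
    · rcases List.append_eq_append_iff.mp hD with ⟨E, rfl, hE⟩ | ⟨E, rfl, rfl⟩
      · obtain ⟨P₁, P₂, rfl, rfl, rfl⟩ := closing_eq_append hE
        simp
      · have := hμ D E rfl
        simp
        omega
    · obtain ⟨P₁, P₂, rfl, rfl, rfl⟩ := opening_eq_append hD
      simp
  · simp
    omega

lemma exists_longRun {U V M : List (Paren T)} {P : List T} {k l n : ℕ} {c : ℝ≥0∞}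
    (hM : Shallow k M) (hP : 6 * k + (k + 1) * l < P.length) (hn : n ≤ k)
    (h : Parse w (U ++ opening P ++ M ++ closing P ++ V) n c) :
    ∃ A F S A' S' c₁ n₂ c₂, P = A ++ F ++ S ∧ P = A' ++ F ++ S' ∧ F.length = l + 1 ∧
      Context w (U ++ opening A) (closing A' ++ V) c₁ ∧
      Parse w (opening S ++ M ++ closing S') n₂ c₂ ∧ n₂ ≤ k ∧ c₁ + c₂ ≤ c := by
  obtain ⟨μ, hμ, hk⟩ := hM
  have h₀ := hμ [] M rfl
  have h₁ := hμ M [] (by simp)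
  rw [rise_nil] at h₀
  have hkl : 0 ≤ (k + 1) * l := Nat.zero_le _
  obtain ⟨X, S, S', Y, B, B', n₁, n₂, c₁, c₂, hX, hY, hB, hB', hctx, hp, hnn, hcc, hlen⟩ :
      ∃ X S S' Y B B' n₁ n₂ c₁ c₂, U ++ opening P = X ++ opening S ∧
        closing P ++ V = closing S' ++ Y ∧ P = B ++ S ∧ P = B' ++ S' ∧ Context w X Y c₁ ∧
        Parse w (opening S ++ M ++ closing S') n₂ c₂ ∧ n₁ + n₂ ≤ n ∧ c₁ + c₂ ≤ c ∧
        (P.length ≤ S.length + 2 * n₁ ∨ P.length ≤ S'.length + 2 * n₁) := by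
    by_cases hout : P.length < (U ++ opening P).length ∨ P.length < (closing P ++ V).length
    · obtain ⟨A, L, C, R, n₁, n₂, c₁, c₂, hA, hC, hctx, hp, hnn, hcc, hL, hR, hlen⟩ :=
        exists_context_enter (U := U) (V := V) hμ _ _ _ n c le_rfl (by simpa using h)
          List.suffix_rfl List.prefix_rfl hout (by omega) (by omega)
      obtain ⟨Z, hZ⟩ := List.suffix_of_suffix_length_le (l₁ := L) (l₃ := U ++ opening P)
        (l₂ := opening P) ⟨A, hA.symm⟩ (List.suffix_append _ _) (by simpa using hL)
      obtain ⟨Z', hZ'⟩ := List.prefix_of_prefix_length_le (l₁ := R) (l₃ := closing P ++ V)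
        (l₂ := closing P) ⟨C, hC.symm⟩ (List.prefix_append _ _) (by simpa using hR)
      obtain ⟨B, S, hB, -, rfl⟩ := opening_eq_append hZ.symm
      obtain ⟨B', S', hB', rfl, -⟩ := closing_eq_append hZ'.symm
      exact ⟨A, S, S', C, B, B', n₁, n₂, c₁, c₂, hA, hC, hB, hB', hctx, hp, hnn, hcc,
        by simpa using hlen⟩
    -- Here `U` and `V` are empty, so there is nothing to peel before `P`.
    · simp only [not_or, not_lt, List.length_append, length_opening, length_closing] at hout
      have hU : U = [] := by
        rw [← List.length_eq_zero_iff]; omega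
      have hV : V = [] := by
        rw [← List.length_eq_zero_iff]; omega
      subst hU hV
      exact ⟨[], P, P, [], [], [], 0, n, 0, c, by simp, by simp, rfl, rfl, .nil, by simpa using h,
        by omega, by simp, by simp⟩
  -- Only one of `S`, `S'` is known to be long; the total height of the inner parse bounds the
  -- difference of their lengths.
  have hb := (hp.rise_bounds [] _ (List.nil_append _).symm).2
  simp only [rise_append, rise_opening, rise_closing] at hb
  have hb' := (hp.rise_bounds _ [] (List.append_nil _).symm).1
  simp only [rise_append, rise_opening, rise_closing] at hb'
  rcases longRun_or_length_le hμ l _ [] S S' n₂ c₂ le_rfl (by simp) hp with h | h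
  · obtain ⟨A, F, S, A', S', d₁, m, d₂, rfl, rfl, hF, hctx', hp', hm, hd⟩ := h
    refine ⟨B ++ A, F, S, B' ++ A', S', c₁ + d₁, m, d₂, by simpa using hB, by simpa using hB',
      hF, ?_, hp', by omega, ?_⟩
    · have hX' : U ++ opening (B ++ A) = X ++ opening A := by
        apply List.append_cancel_right (bs := opening (F ++ S))
        simpa [hB] using hX
      have hY' : closing (B' ++ A') ++ V = closing A' ++ Y := by
        apply List.append_cancel_left (as := closing (F ++ S'))
        simpa [hB'] using hY
      rw [hX', hY']
      exact hctx.comp hctx'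
    · rw [add_assoc]
      exact (add_le_add_right hd _).trans hcc
  -- The `6 * k` is tight when `S'` is the long one: at most `2 * n₁ + 4 * n₂ ≤ 4 * k` from edits,
  -- and `rise M - μ ≤ 2 * k` from shallowness.
  · exfalso
    have : ((n₂ : ℤ) + 1) * l ≤ (k + 1) * l := by gcongr; omega
    zify at hP
    simp at h
    rcases hlen with hlen | hlen <;> omega

/-! ## Powers and periods -/

lemma power_succ {A : Type*} (Q : List A) (e : ℕ) : power Q (e + 1) = Q ++ power Q e := by
  simp [power, List.replicate_succ]

lemma power_succ_eq_append {A : Type*} (Q : List A) (e : ℕ) :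
    power Q (e + 1) = power Q e ++ Q := by
  simp [power, List.replicate_succ']

lemma length_power {A : Type*} (Q : List A) (e : ℕ) : (power Q e).length = e * Q.length := by
  simp [power]

/-- `Q` commutes with its power, so Q A F S = A F S Q; comparing prefixes gives Q A = A F. -/
lemma insert_factor_power {α : Type*} {Q A F S : List α} {e : ℕ} (h : power Q e = A ++ F ++ S)
    (hF : F.length = Q.length) : power Q (e + 1) = A ++ F ++ F ++ S := by
  have h₁ : Q ++ A ++ (F ++ S) = A ++ F ++ (S ++ Q) := by
    have := (power_succ Q e).symm.trans (power_succ_eq_append Q e)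
    simpa [h] using this
  have h₂ := (List.append_inj h₁ (by simp [hF, add_comm])).1
  rw [power_succ, h]
  simp only [← List.append_assoc]
  rw [h₂]

lemma remove_factor_power {α : Type*} {Q A F S : List α} {e : ℕ} (h : power Q (e + 1) = A ++ F ++ S)
    (hF : F.length = Q.length) : power Q e = A ++ S := by
  have h₁ := insert_factor_power h hF
  have h₂ : Q ++ A ++ (F ++ S) = A ++ F ++ (F ++ S) := by
    rw [power_succ, h] at h₁
    simpa using h₁
  have h₃ := (List.append_inj h₂ (by simp [hF, add_comm])).1
  rw [power_succ, ← h₃, List.append_assoc] at h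
  exact List.append_cancel_left h

lemma power_prefix_of_prefix {α : Type*} {G F : List α} (h : F <+: G ++ F) (N : ℕ)
    (hN : N * G.length ≤ F.length) : power G (N + 1) <+: G ++ F := by
  induction N with
  | zero => simp [power]
  | succ N ih =>
    rw [power_succ]
    refine (List.prefix_append_right_inj G).mpr (List.prefix_of_prefix_length_le
      (ih ((Nat.mul_le_mul_right _ N.le_succ).trans hN)) h ?_)
    rwa [length_power]

/-- A long factor with two occurrences at distance `δ` produces a high power of period `δ`. -/
lemma exists_power_of_two_occurrences {α : Type*} {P A F S A' S' : List α} (h : P = A ++ F ++ S)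
    (h' : P = A' ++ F ++ S') {N : ℕ} (hlt : S.length < S'.length)
    (hN : N * (S'.length - S.length) ≤ F.length) :
    ∃ Q, Q.length = S'.length - S.length ∧ power Q (N + 1) <:+: P := by
  have hl := congrArg List.length h
  have hl' := congrArg List.length h'
  simp only [List.length_append] at hl hl'
  obtain ⟨G, rfl⟩ : A' <+: A := List.prefix_of_prefix_length_le (l₃ := P)
    ⟨F ++ S', by simp [h']⟩ ⟨F ++ S, by simp [h]⟩ (by omega)
  simp only [List.length_append] at hl
  have hG : G.length = S'.length - S.length := by omega
  have hF : F <+: G ++ F := by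
    refine List.prefix_of_prefix_length_le (l₃ := G ++ F ++ S) ⟨S', ?_⟩ (List.prefix_append _ _)
      (by simp)
    apply List.append_cancel_left (as := A')
    rw [← List.append_assoc, ← h', h]
    simp
  obtain ⟨D, hD⟩ := power_prefix_of_prefix hF N (hG ▸ hN)
  exact ⟨G, hG, A', D ++ S, by rw [h, List.append_assoc A' G F, ← hD]; simp⟩

/-! ## Equivalence -/

/-- The equivalence of `P` and `P'`, in terms of decompositions of strings. -/
def Interchangeable (w : ParenEps T → ParenEps T → ℝ≥0∞) (k : ℕ) (P P' : List T) : Prop :=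
  ∀ U M V, Shallow k M → dyckLe w k (U ++ opening P ++ M ++ closing P ++ V) =
    dyckLe w k (U ++ opening P' ++ M ++ closing P' ++ V)

lemma Interchangeable.symm {k : ℕ} {P P' : List T} (h : Interchangeable w k P P') :
    Interchangeable w k P' P := fun U M V hM => (h U M V hM).symm

lemma Interchangeable.trans {k : ℕ} {P P' P'' : List T} (h : Interchangeable w k P P')
    (h' : Interchangeable w k P' P'') : Interchangeable w k P P'' :=
  fun U M V hM => (h U M V hM).trans (h' U M V hM)

/-- `A` joins the outer strings, and `B` joins `M`, which stays shallow. -/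
lemma Interchangeable.append {k : ℕ} {P P' : List T} (h : Interchangeable w k P P')
    (A B : List T) : Interchangeable w k (A ++ P ++ B) (A ++ P' ++ B) := by
  intro U M V hM
  simpa using h (U ++ opening A) _ (closing A ++ V) (hM.surround B)

lemma take_append_fragment {α : Type*} (X : List α) {i j : ℕ} (h : i ≤ j) :
    X.take i ++ fragment X i j = X.take j := by
  conv_rhs => rw [← List.take_append_drop i (X.take j), List.take_take, min_eq_left h]
  rfl

lemma rise_fragment {X : List (Paren T)} {i j : ℕ} (h : i ≤ j) :
    rise (fragment X i j) = height X j - height X i := by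
  have := congrArg rise (take_append_fragment X h)
  rw [rise_append] at this
  change height X i + _ = height X j at this
  omega

lemma Synchronized.shallow {k : ℕ} {X : List (Paren T)} {a b c d : ℕ}
    (h : Synchronized k X a b c d) : Shallow k (fragment X b c) := by
  have hbc := h.b_le_c
  refine ⟨(Finset.Icc b c).inf' (Finset.nonempty_Icc.mpr hbc) (height X) - height X b, ?_, ?_⟩
  · intro M₁ M₂ hM
    have hl : M₁.length ≤ c - b := by
      have := congrArg List.length hM
      simp [fragment] at this
      omega
    have hM₁ : M₁ = fragment X b (b + M₁.length) := by
      have := congrArg (List.take M₁.length) hM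
      rw [List.take_left, fragment, List.take_drop, List.take_take, min_eq_left (by omega)] at this
      exact this.symm
    rw [hM₁, rise_fragment (by omega)]
    exact sub_le_sub_right (Finset.inf'_le _ (by simp; omega)) _
  · rw [rise_fragment hbc]
    have := h.height_le
    omega

lemma Interchangeable.dyckEquiv {k : ℕ} {P P' : List T} (h : Interchangeable w k P P') :
    DyckEquiv w k P P' := by
  intro X a b c d hs hP hP'
  have hX : X = fragment X 0 a ++ opening P ++ fragment X b c ++ closing P ++
      fragment X d X.length := by
    have h₀ : fragment X 0 a = X.take a := rfl
    rw [closing, ← hP', ← hP, h₀, take_append_fragment X hs.a_le_b,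
      take_append_fragment X hs.b_le_c, take_append_fragment X hs.c_le_d,
      take_append_fragment X hs.d_le_length, List.take_length]
  conv_lhs => rw [hX]
  exact h _ _ _ hs.shallow

lemma dyck_le_dyck (hw : IsSkewmetric w) (hn : IsNormalized w) {k : ℕ} {X X' : List (Paren T)}
    (h : ∀ n c, n ≤ k → Parse w X n c → ∃ n' c', Parse w X' n' c' ∧ c' ≤ c)
    (hX : dyck w X ≤ k) : dyck w X' ≤ dyck w X := by
  refine le_of_forall_gt_imp_ge_of_dense fun b hb => ?_
  -- The infimum need not be attained. Cost below `k + 1` suffices, because the number of edits is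
  -- an integer.
  have hk : dyck w X < (k : ℝ≥0∞) + 1 :=
    hX.trans_lt (ENNReal.lt_add_right (ENNReal.natCast_ne_top k) one_ne_zero)
  obtain ⟨n, c, hp, hc⟩ := exists_parse_of_dyck_lt hw (lt_min hb hk)
  have hnk : n ≤ k := by
    have := (hp.edits_le hn).trans_lt (hc.trans_le (min_le_right _ _))
    exact Nat.lt_succ_iff.mp (by exact_mod_cast this)
  obtain ⟨n', c', hp', hc'⟩ := h n c hnk hp
  exact (hp'.dyck_le hw.toIsWeight).trans (hc'.trans (hc.le.trans (min_le_left _ _)))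

lemma interchangeable_of_parse (hw : IsSkewmetric w) (hn : IsNormalized w) {k : ℕ}
    {P P' : List T}
    (h : ∀ U M V n c, Shallow k M → n ≤ k → Parse w (U ++ opening P ++ M ++ closing P ++ V) n c →
      ∃ n' c', Parse w (U ++ opening P' ++ M ++ closing P' ++ V) n' c' ∧ c' ≤ c)
    (h' : ∀ U M V n c, Shallow k M → n ≤ k →
      Parse w (U ++ opening P' ++ M ++ closing P' ++ V) n c →
      ∃ n' c', Parse w (U ++ opening P ++ M ++ closing P ++ V) n' c' ∧ c' ≤ c) :
    Interchangeable w k P P' := by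
  intro U M V hM
  have h₁ := dyck_le_dyck hw hn (fun n c => h U M V n c hM)
  have h₂ := dyck_le_dyck hw hn (fun n c => h' U M V n c hM)
  have hk : (((k : ℝ≥0) : ℝ≥0∞)) = k := by simp
  unfold dyckLe
  rw [hk]
  split_ifs with hX hX' hX'
  · exact le_antisymm (h₂ hX') (h₁ hX)
  · exact absurd ((h₁ hX).trans hX) hX'
  · exact absurd ((h₂ hX').trans hX') hX
  · rfl

/-! ## Powers are interchangeable -/

lemma exists_factor_of_power {Q : List T} {e k n : ℕ} {U M V : List (Paren T)} {c : ℝ≥0∞}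
    (hk : 0 < k) (hQ : Q ≠ []) (he : 8 * k ≤ e) (hM : Shallow k M) (hn : n ≤ k)
    (h : Parse w (U ++ opening (power Q e) ++ M ++ closing (power Q e) ++ V) n c) :
    ∃ A F S A' S' c₁ n₂ c₂, power Q e = A ++ F ++ S ∧ power Q e = A' ++ F ++ S' ∧
      F.length = Q.length ∧ Context w (U ++ opening A) (closing A' ++ V) c₁ ∧
      Parse w (opening S ++ M ++ closing S') n₂ c₂ ∧ c₁ + c₂ ≤ c := by
  have hq := List.length_pos_iff.mpr hQ
  obtain ⟨l, hl⟩ : ∃ l, Q.length = l + 1 := ⟨Q.length - 1, by omega⟩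
  have hlen : 6 * k + (k + 1) * l < (power Q e).length := by
    rw [length_power, hl]
    calc 6 * k + (k + 1) * l < 8 * k * (l + 1) := by nlinarith [Nat.zero_le (k * l)]
      _ ≤ e * (l + 1) := Nat.mul_le_mul_right _ he
  obtain ⟨A, F, S, A', S', c₁, n₂, c₂, h₁, h₂, hF, hctx, hp, -, hc⟩ := exists_longRun hM hlen hn h
  exact ⟨A, F, S, A', S', c₁, n₂, c₂, h₁, h₂, hF.trans hl.symm, hctx, hp, hc⟩

lemma interchangeable_power_succ (hw : IsSkewmetric w) (hnw : IsNormalized w) {Q : List T}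
    {e k : ℕ} (hk : 0 < k) (he : 8 * k ≤ e) :
    Interchangeable w k (power Q e) (power Q (e + 1)) := by
  by_cases hQ : Q = []
  · subst hQ
    intro U M V _
    simp [power]
  refine interchangeable_of_parse hw hnw (fun U M V n c hM hn h => ?_)
    (fun U M V n c hM hn h => ?_)
  · obtain ⟨A, F, S, A', S', c₁, n₂, c₂, h₁, h₂, hF, hctx, hp, hc⟩ :=
      exists_factor_of_power hk hQ he hM hn h
    obtain ⟨m, hm⟩ := hctx _ _ _ ((hp.surround F).surround F)
    refine ⟨m, _, hm.congr ?_, (add_comm _ _).trans_le hc⟩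
    conv_rhs => rw [insert_factor_power h₁ hF]
    -- The two sides are cut at possibly different places, but both insertions produce the same
    -- power.
    have : closing (A ++ F ++ F ++ S) = closing (A' ++ F ++ F ++ S') := by
      rw [← insert_factor_power h₁ hF, ← insert_factor_power h₂ hF]
    rw [this]
    simp
  · obtain ⟨A, F, S, A', S', c₁, n₂, c₂, h₁, h₂, hF, hctx, hp, hc⟩ :=
      exists_factor_of_power hk hQ (he.trans e.le_succ) hM hn h
    obtain ⟨m, hm⟩ := hctx _ _ _ hp
    refine ⟨m, _, hm.congr ?_, (add_comm _ _).trans_le hc⟩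
    conv_rhs => rw [remove_factor_power h₁ hF]
    have : closing (A ++ S) = closing (A' ++ S') := by
      rw [← remove_factor_power h₁ hF, ← remove_factor_power h₂ hF]
    rw [this]
    simp

lemma interchangeable_power (hw : IsSkewmetric w) (hnw : IsNormalized w) (Q : List T)
    {e e' k : ℕ} (hk : 0 < k) (he : 8 * k ≤ e) (he' : 8 * k ≤ e') :
    Interchangeable w k (power Q e) (power Q e') := by
  have key (m : ℕ) : Interchangeable w k (power Q (8 * k)) (power Q (8 * k + m)) := by
    induction m with
    | zero => exact fun _ _ _ _ => rfl
    | succ m ih => exact ih.trans (interchangeable_power_succ hw hnw hk (by omega))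
  obtain ⟨m, rfl⟩ := Nat.exists_eq_add_of_le he
  obtain ⟨m', rfl⟩ := Nat.exists_eq_add_of_le he'
  exact (key m).symm.trans (key m')

/-! ## Strings avoiding periodicity -/

/-- If `P` is long and avoids periodicity, every cheap parse of `U P M P̄ V` separates at some
decomposition `P = A S` into a context for the string `S M S̄` and a parse of this string. -/
lemma exists_context_of_avoidsPeriodicity {k n : ℕ} (hk : 0 < k) {P : List T}
    (hP : 78 * k ^ 3 ≤ P.length) (ha : AvoidsPeriodicity k P) {U M V : List (Paren T)} {c : ℝ≥0∞}
    (hM : Shallow k M) (hn : n ≤ k) (h : Parse w (U ++ opening P ++ M ++ closing P ++ V) n c) :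
    ∃ A S c₁ n₂ c₂, P = A ++ S ∧ Context w (U ++ opening A) (closing A ++ V) c₁ ∧
      Parse w (opening S ++ M ++ closing S) n₂ c₂ ∧ n₂ ≤ k ∧ c₁ + c₂ ≤ c := by
  -- The left side is at most `70 * k ^ 3`.
  have hlen : 6 * k + (k + 1) * (32 * k ^ 2) < P.length := by
    have h₁ : k ≤ k ^ 3 := Nat.le_self_pow (by norm_num) k
    have h₂ : k ^ 2 ≤ k ^ 3 := Nat.pow_le_pow_right hk (by norm_num)
    have h₃ : (k + 1) * (32 * k ^ 2) = 32 * k ^ 3 + 32 * k ^ 2 := by ring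
    have h₄ : 0 < k ^ 3 := by positivity
    omega
  obtain ⟨A, F, S, A', S', c₁, n₂, c₂, h₁, h₂, hF, hctx, hp, hn₂, hc⟩ :=
    exists_longRun hM hlen hn h
  obtain ⟨μ, hμ, hk'⟩ := hM
  have hμ₀ := hμ [] M rfl
  have hμ₁ := hμ M [] (by simp)
  rw [rise_nil] at hμ₀
  have hb := (hp.rise_bounds [] _ (List.nil_append _).symm).2
  have hb' := (hp.rise_bounds _ [] (List.append_nil _).symm).1
  simp only [rise_append, rise_opening, rise_closing] at hb hb'
  -- The shift is at most `4 * k`: `2 * k` from the edits and `2 * k` from the rise of `M`. A run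
  -- longer than `32 * k ^ 2` then holds `8 * k` periods.
  have hbound {m : ℕ} (hm : m ≤ 4 * k) : 8 * k * m ≤ F.length := by
    rw [hF]
    calc 8 * k * m ≤ 8 * k * (4 * k) := Nat.mul_le_mul_left _ hm
      _ ≤ 32 * k ^ 2 + 1 := by nlinarith
  rcases lt_trichotomy S.length S'.length with hlt | heq | hlt
  · obtain ⟨Q, hQ, hQP⟩ := exists_power_of_two_occurrences h₁ h₂ hlt (hbound (by omega))
    exact absurd ⟨Q, by omega, by omega, hQP⟩ ha
  · obtain ⟨hA, rfl⟩ := List.append_inj' (h₁.symm.trans h₂) heq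
    obtain rfl := List.append_cancel_right hA
    exact ⟨A, F ++ S, c₁, n₂, c₂, by simpa using h₁, hctx,
      (hp.surround F).congr (by simp), hn₂, hc⟩
  · obtain ⟨Q, hQ, hQP⟩ := exists_power_of_two_occurrences h₂ h₁ hlt (hbound (by omega))
    exact absurd ⟨Q, by omega, by omega, hQP⟩ ha

lemma exists_parse_replace_middle {k n : ℕ} (hk : 0 < k) {R S : List T}
    (hR : 78 * k ^ 3 ≤ R.length) (haR : AvoidsPeriodicity k R) (hS : 78 * k ^ 3 ≤ S.length)
    (haS : AvoidsPeriodicity k S) (B B' : List T) {U M V : List (Paren T)} {c : ℝ≥0∞}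
    (hM : Shallow k M) (hn : n ≤ k)
    (h : Parse w (U ++ opening (R ++ B ++ S) ++ M ++ closing (R ++ B ++ S) ++ V) n c) :
    ∃ n' c', Parse w (U ++ opening (R ++ B' ++ S) ++ M ++ closing (R ++ B' ++ S) ++ V) n' c' ∧
      c' ≤ c := by
  obtain ⟨R₁, R₂, c₁, n₂, c₂, rfl, hctx, hp, hn₂, hc⟩ :=
    exists_context_of_avoidsPeriodicity hk hR haR (hM.surround (B ++ S)) hn
      (U := U) (V := V) (h.congr (by simp))
  obtain ⟨S₁, S₂, c₃, n₄, c₄, rfl, -, hp', -, hc'⟩ :=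
    exists_context_of_avoidsPeriodicity hk hS haS hM hn₂
      (U := opening (R₂ ++ B)) (V := closing (R₂ ++ B)) (hp.congr (by simp))
  -- Everything between the two cuts is discarded, with its cost, and replaced by an exact matching,
  -- so `B'` is arbitrary.
  obtain ⟨m, hm⟩ := hctx _ _ _ (hp'.surround (R₂ ++ B' ++ S₁))
  refine ⟨m, _, hm.congr (by simp), ?_⟩
  calc c₄ + c₁ ≤ c₂ + c₁ := add_le_add_left (le_add_self.trans hc') _
    _ ≤ c := (add_comm _ _).trans_le hc

lemma interchangeable_of_avoidsPeriodicity (hw : IsSkewmetric w) (hnw : IsNormalized w) {k : ℕ}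
    (hk : 0 < k) {R S : List T} (hR : 78 * k ^ 3 ≤ R.length) (haR : AvoidsPeriodicity k R)
    (hS : 78 * k ^ 3 ≤ S.length) (haS : AvoidsPeriodicity k S) (B B' : List T) :
    Interchangeable w k (R ++ B ++ S) (R ++ B' ++ S) :=
  interchangeable_of_parse hw hnw
    (fun _ _ _ _ _ hM hn h => exists_parse_replace_middle hk hR haR hS haS B B' hM hn h)
    (fun _ _ _ _ _ hM hn h => exists_parse_replace_middle hk hR haR hS haS B' B hM hn h)

lemma eq_prefix_middle_suffix {α : Type*} {P : List α} {r : ℕ} (h : 2 * r ≤ P.length) :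
    P = fragment P 0 r ++ fragment P r (P.length - r) ++ fragment P (P.length - r) P.length := by
  have h₀ : fragment P 0 r = P.take r := rfl
  rw [h₀, take_append_fragment P (by omega), take_append_fragment P (by omega), List.take_length]

lemma AvoidsPeriodicity.of_infix {k : ℕ} {P P' : List T} (h : AvoidsPeriodicity k P)
    (hP : P' <:+: P) : AvoidsPeriodicity k P' :=
  fun ⟨Q, h₁, h₂, h₃⟩ => h ⟨Q, h₁, h₂, h₃.trans hP⟩

/-- Every string is interchangeable, uniformly in the weight function, with one of length at most
`156 k ^ 3`. -/
lemma exists_short_interchangeable {k : ℕ} (hk : 0 < k) :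
    ∀ (N : ℕ) (P : List T), P.length ≤ N → ∃ P' : List T, P'.length ≤ 156 * k ^ 3 ∧
      ∀ w : ParenEps T → ParenEps T → ℝ≥0∞, IsSkewmetric w → IsNormalized w →
        Interchangeable w k P P' := by
  intro N
  induction N with
  | zero => exact fun P hP => ⟨P, by omega, fun _ _ _ _ _ _ _ => rfl⟩
  | succ N ih =>
    intro P hP
    by_cases hshort : P.length ≤ 156 * k ^ 3
    · exact ⟨P, hshort, fun _ _ _ _ _ _ _ => rfl⟩
    by_cases ha : AvoidsPeriodicity k P
    · have hr : 78 * k ^ 3 + 78 * k ^ 3 = 156 * k ^ 3 := by ring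
      have hPP := eq_prefix_middle_suffix (P := P) (r := 78 * k ^ 3) (by omega)
      set r := 78 * k ^ 3
      have hR : (fragment P 0 r).length = r := by simp [fragment]; omega
      have hS : (fragment P (P.length - r) P.length).length = r := by simp [fragment]; omega
      refine ⟨fragment P 0 r ++ [] ++ fragment P (P.length - r) P.length, ?_, ?_⟩
      · simp only [List.length_append, hR, hS, List.length_nil]
        omega
      · intro w hw hnw
        conv in Interchangeable w k P _ => arg 3; rw [hPP]
        refine interchangeable_of_avoidsPeriodicity hw hnw hk hR.ge (ha.of_infix ?_) hS.ge
          (ha.of_infix ?_) _ _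
        · simpa [fragment] using (List.take_prefix r P).isInfix
        · simpa [fragment] using (List.drop_suffix (P.length - r) P).isInfix
    · obtain ⟨Q, h₁, h₂, A, B, rfl⟩ := not_not.mp ha
      -- Dropping one copy of the nonempty `Q` shortens the string.
      obtain ⟨P', hP', h⟩ := ih (A ++ power Q (8 * k) ++ B) (by
        simp only [List.length_append, length_power, add_mul] at hP ⊢
        omega)
      exact ⟨P', hP', fun w hw hnw => ((interchangeable_power hw hnw Q hk (by omega)
        le_rfl).append A B).trans (h w hw hnw)⟩

end DyckEdit

/-- For every integer `k ≥ 1`: (1) `Q^e` and `Q^{e'}` with `e, e' ≥ 8k` are equivalent; (2) two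
strings of length at least `156k³` with the same prefix and the same suffix of length `78k³`, both
avoiding `k`-periodicity, are equivalent; (3) every string of opening parentheses is equivalent to
one of length at most `156k³`. Here equivalence is `dyck^w_{≤ k}`-equivalence, simultaneously for all
normalized skewmetric weight functions `w`. -/
theorem mainTheorem12 {T : Type*} (k : ℕ) (hk : 0 < k) :
    (∀ (Q : List T) (e e' : ℕ), 8 * k ≤ e → 8 * k ≤ e' →
      ∀ w : ParenEps T → ParenEps T → ℝ≥0∞, IsSkewmetric w → IsNormalized w →
        DyckEquiv w k (power Q e) (power Q e')) ∧
    (∀ P P' : List T, 156 * k ^ 3 ≤ P.length → 156 * k ^ 3 ≤ P'.length →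
      fragment P 0 (78 * k ^ 3) = fragment P' 0 (78 * k ^ 3) →
      fragment P (P.length - 78 * k ^ 3) P.length =
        fragment P' (P'.length - 78 * k ^ 3) P'.length →
      AvoidsPeriodicity k (fragment P 0 (78 * k ^ 3)) →
      AvoidsPeriodicity k (fragment P (P.length - 78 * k ^ 3) P.length) →
      ∀ w : ParenEps T → ParenEps T → ℝ≥0∞, IsSkewmetric w → IsNormalized w →
        DyckEquiv w k P P') ∧
    (∀ P : List T, ∃ P' : List T, P'.length ≤ 156 * k ^ 3 ∧
      ∀ w : ParenEps T → ParenEps T → ℝ≥0∞, IsSkewmetric w → IsNormalized w →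
        DyckEquiv w k P P') := by
  refine ⟨fun Q e e' he he' w hw hnw => (interchangeable_power hw hnw Q hk he he').dyckEquiv,
    fun P P' hP hP' hpre hsuf haR haS w hw hnw => ?_, fun P => ?_⟩
  · have hr : 78 * k ^ 3 + 78 * k ^ 3 = 156 * k ^ 3 := by ring
    have h₁ := eq_prefix_middle_suffix (P := P) (r := 78 * k ^ 3) (by omega)
    have h₂ := eq_prefix_middle_suffix (P := P') (r := 78 * k ^ 3) (by omega)
    rw [← hpre, ← hsuf] at h₂
    have h := interchangeable_of_avoidsPeriodicity hw hnw hk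
      (by simp [fragment]; omega) haR (by simp [fragment]; omega) haS
      (fragment P (78 * k ^ 3) (P.length - 78 * k ^ 3))
      (fragment P' (78 * k ^ 3) (P'.length - 78 * k ^ 3))
    rw [← h₁, ← h₂] at h
    exact h.dyckEquiv
  · obtain ⟨P', hP', h⟩ := exists_short_interchangeable hk _ P le_rfl
    exact ⟨P', hP', fun w hw hnw => (h w hw hnw).dyckEquiv⟩
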